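/- \textbf{Setting.} All quantum systems are finite-dimensional. A state is a positive semidefinite operator of unit trace, and a channel $\mathcal{N}_{A\to B}$ is a completely positive trace-preserving linear map from operators on $A$ to operators on $B$; $\mathcal{N}_{A\to B}(\rho_{RA})$ means $(\mathrm{id}_R\otimes\mathcal{N})(\rho_{RA})$, and $\rho_A=\operatorname{Tr}_R[\rho_{RA}]$. For positive semidefinite operators $\rho,\sigma$, the Belavkin--Staszewski relative entropy is $$\widehat D(\rho\|\sigma):=\operatorname{Tr}\!\left[\rho^{1/2}\ln\!\left(\rho^{1/2}\sigma^{-1}\rho^{1/2}\right)\rho^{1/2}\right]\ \text{ if } \operatorname{supp}(\rho)\subseteq\operatorname{supp}(\sigma),\qquad \widehat D(\rho\|\sigma):=+\infty\ \text{ otherwise,}$$ where the inverse and the logarithm are taken on the supports. For a Hermitian operator $H_A$, a real number $E$ and channels $\mathcal{N}_{A\to B},\mathcal{M}_{A\to B}$, the energy-constrained Belavkin--Staszewski channel divergence is $$\widehat D_{H,E}(\mathcal{N}\|\mathcal{M}):=\sup_{\psi_{RA}:\ \operatorname{Tr}[H_A\psi_A]\le E}\widehat D\big(\mathcal{N}_{A\to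 B}(\psi_{RA})\,\big\|\,\mathcal{M}_{A\to B}(\psi_{RA})\big)\in[-\infty,+\infty],$$ where the supremum is over all finite-dimensional systems $R$ and all pure states $\psi_{RA}$ with $\operatorname{Tr}[H_A\psi_A]\le E$. \textbf{Lemma (chain rule).} Let $H_A$ be a grounded Hamiltonian on $A$, i.e., a Hermitian operator whose minimum eigenvalue is zero, and let $E>0$. Let $\mathcal{N}_{A\to B}$ and $\mathcal{M}_{A\to B}$ be arbitrary channels, let $\rho_{RA}$ be a state with $\operatorname{Tr}[H_A\rho_A]\le E$, and let $\sigma_{RA}$ be an arbitrary state. Then $$\widehat D\big(\mathcal{N}_{A\to B}(\rho_{RA})\,\big\|\,\mathcal{M}_{A\to B}(\sigma_{RA})\big)\le \widehat D(\rho_{RA}\|\sigma_{RA})+\widehat D_{H,E}(\mathcal{N}\|\mathcal{M}),$$ as an inequality in $(-\infty,+\infty]$. -/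

import Mathlib

open scoped ComplexOrder

/-!
Quantum systems are finite-dimensional; a system `A` is represented by its (finite) index set `a`
of an orthonormal basis, and operators on it by matrices in `Matrix a a ℂ`.  The composite system
`RA` has index set `r × a`.
-/

noncomputable section

/-- A quantum state (density operator): positive semidefinite with unit trace. -/
structure IsQuantumState {a : Type*} [Fintype a] (ρ : Matrix a a ℂ) : Prop where
  posSemidef : ρ.PosSemidef
  trace_eq_one : ρ.trace = 1

/-- The reduced operator `X_A = Tr_R[X_{RA}]`. -/
def partialTraceLeft {r a : Type*} [Fintype r] (X : Matrix (r × a) (r × a) ℂ) : Matrix a a ℂ :=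
  Matrix.of fun i j => ∑ k, X (k, i) (k, j)

/-- The operator `(id_R ⊗ 𝒩)(X_{RA})`: apply `𝒩` to each `A`-block of `X_{RA}`. -/
def idTensorMap {a b : Type*} (r : Type*) (𝒩 : Matrix a a ℂ →ₗ[ℂ] Matrix b b ℂ)
    (X : Matrix (r × a) (r × a) ℂ) : Matrix (r × b) (r × b) ℂ :=
  Matrix.of fun p q => 𝒩 (Matrix.of fun i j => X (p.1, i) (q.1, j)) p.2 q.2

/-- A quantum channel: a completely positive, trace-preserving linear map. -/
structure IsQuantumChannel {a b : Type*} [Fintype a] [Fintype b]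
    (𝒩 : Matrix a a ℂ →ₗ[ℂ] Matrix b b ℂ) : Prop where
  completelyPositive : ∀ (n : ℕ) (X : Matrix (Fin n × a) (Fin n × a) ℂ),
    X.PosSemidef → (idTensorMap (Fin n) 𝒩 X).PosSemidef
  tracePreserving : ∀ X : Matrix a a ℂ, (𝒩 X).trace = X.trace

/-- The operator relative entropy `X^{1/2} ln (X^{1/2} Y⁻¹ X^{1/2}) X^{1/2}` of positive
semidefinite `X`, `Y` with `supp X ⊆ supp Y`.  Since `0⁻¹ = 0` and `Real.log 0 = 0`, the inverse is
the one on the support of `Y`, and the logarithm is the one on the support of its argument. -/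
def opRelEntropy {a : Type*} [Fintype a] [DecidableEq a] (X Y : Matrix a a ℂ) : Matrix a a ℂ :=
  cfc Real.sqrt X *
    cfc Real.log (cfc Real.sqrt X * cfc (fun t : ℝ => t⁻¹) Y * cfc Real.sqrt X) *
    cfc Real.sqrt X

open Classical in
/-- The Belavkin–Staszewski relative entropy of positive semidefinite operators: the trace of the
operator relative entropy if `supp ρ ⊆ supp σ` (i.e. `ker σ ⊆ ker ρ`), and `+∞` otherwise. -/
def bsRelEntropy {a : Type*} [Fintype a] [DecidableEq a] (ρ σ : Matrix a a ℂ) : EReal :=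
  if LinearMap.ker σ.mulVecLin ≤ LinearMap.ker ρ.mulVecLin then
    (((opRelEntropy ρ σ).trace.re : ℝ) : EReal)
  else ⊤

/-- A grounded Hamiltonian: Hermitian, with minimum eigenvalue equal to zero. -/
structure IsGroundedHamiltonian {a : Type*} [Fintype a] [DecidableEq a] (H : Matrix a a ℂ) :
    Prop where
  isHermitian : H.IsHermitian
  isLeast_zero : IsLeast (spectrum ℝ H) 0

/-- The rank-one operator `|ψ⟩⟨ψ|`. -/
def pureState {a : Type*} (ψ : a → ℂ) : Matrix a a ℂ :=
  Matrix.vecMulVec ψ (star ψ)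

/-- The energy-constrained Belavkin–Staszewski channel divergence: the supremum over all reference
systems `R` of finite dimension `n` and all unit vectors `ψ_{RA}` with `Tr[H_A ψ_A] ≤ E`. -/
def ecbsDivergence {a b : Type*} [Fintype a] [Fintype b] [DecidableEq b]
    (H : Matrix a a ℂ) (E : ℝ) (𝒩 ℳ : Matrix a a ℂ →ₗ[ℂ] Matrix b b ℂ) : EReal :=
  ⨆ (n : ℕ) (ψ : Fin n × a → ℂ) (_ : IsQuantumState (pureState ψ))
    (_ : (H * partialTraceLeft (pureState ψ)).trace.re ≤ E),
    bsRelEntropy (idTensorMap (Fin n) 𝒩 (pureState ψ)) (idTensorMap (Fin n) ℳ (pureState ψ))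

end

/-! The Belavkin–Staszewski entropy is the least classical relative entropy over reverse tests, that
is, over splittings `X = ∑ g_k M_k`, `Y = ∑ M_k` with `M_k ≥ 0`. The spectral resolution of
`Y^{-1/2} X Y^{-1/2}` gives a rank-one optimum (`exists_optimal_decomposition`). That no splitting
does better (`trace_opRelEntropy_sum_le`) is convexity of `x log x`, obtained from resolvents.

Split `ρ = ∑ g_i |s_i⟩⟨s_i|`, `σ = ∑ |s_i⟩⟨s_i|` optimally. The vector `ψ = ∑ √g_i |i⟩|s_i⟩`
purifies `ρ`, so it meets the energy constraint. Split `𝒩(ψ)`, `ℳ(ψ)` optimally with ratios `h_k`;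
diagonal blocks then split `g_i 𝒩(s_i)` and `g_i ℳ(s_i)` with those same ratios. Dividing by `g_i`
gives a reverse test for `𝒩(ρ)`, `ℳ(σ)` with ratios `g_i h_k`, and `log (g_i h_k) = log g_i + log
h_k` separates the two entropies. -/

namespace Matrix

/-! ### Positivity and functional calculus of matrices. -/

variable {a : Type*} [Fintype a]

theorem mul_pureState_mul (A : Matrix a a ℂ) (hA : A.IsHermitian) (u : a → ℂ) :
    A * pureState u * A = pureState (A *ᵥ u) := by
  rw [pureState, pureState, Matrix.mul_vecMulVec, Matrix.vecMulVec_mul, star_mulVec, hA.eq]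

theorem PosSemidef.trace_re_nonneg {A : Matrix a a ℂ} (hA : A.PosSemidef) : 0 ≤ A.trace.re :=
  (Complex.le_def.1 hA.trace_nonneg).1

/-- Nonnegative quadratic forms with zero sum vanish one by one, so a vector killed by the sum is
killed by each term. Hence a split pair always satisfies the support condition. -/
theorem ker_sum_le_ker_sum_smul {ι : Type*} [Fintype ι] (g : ι → ℝ) {M : ι → Matrix a a ℂ}
    (hM : ∀ k, (M k).PosSemidef) :
    LinearMap.ker (∑ k, M k).mulVecLin ≤ LinearMap.ker (∑ k, g k • M k).mulVecLin := by
  intro y hy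
  have hy' : (∑ k, M k) *ᵥ y = 0 := hy
  have h0 : ∑ k, star y ⬝ᵥ (M k *ᵥ y) = 0 := by
    rw [← dotProduct_sum, ← sum_mulVec, hy', dotProduct_zero]
  have h1 := (Finset.sum_eq_zero_iff_of_nonneg
    fun k _ => (hM k).dotProduct_mulVec_nonneg y).1 h0
  have h2 : ∀ k, M k *ᵥ y = 0 := fun k =>
    ((hM k).dotProduct_mulVec_zero_iff y).1 (h1 k (Finset.mem_univ k))
  change (∑ k, g k • M k) *ᵥ y = 0
  rw [sum_mulVec]
  exact Finset.sum_eq_zero fun k _ => by rw [smul_mulVec, h2, smul_zero]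

variable [DecidableEq a]

theorem cfc_mul_cfc (f g : ℝ → ℝ) (A : Matrix a a ℂ) :
    cfc f A * cfc g A = cfc (fun x => f x * g x) A :=
  (cfc_mul f g A (A.finite_real_spectrum.continuousOn _)
    (A.finite_real_spectrum.continuousOn _)).symm

theorem isHermitian_cfc (f : ℝ → ℝ) (A : Matrix a a ℂ) : (cfc f A).IsHermitian :=
  cfc_predicate f A

theorem PosSemidef.spectrum_nonneg {A : Matrix a a ℂ} (hA : A.PosSemidef) {x : ℝ}
    (hx : x ∈ spectrum ℝ A) : 0 ≤ x := by
  obtain ⟨i, rfl⟩ := hA.isHermitian.spectrum_real_eq_range_eigenvalues ▸ hx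
  exact hA.eigenvalues_nonneg i

/-- Spectral resolution: every function of a Hermitian matrix is a combination of the same
rank-one projections. -/
theorem IsHermitian.exists_cfc_eq_sum {B : Matrix a a ℂ} (hB : B.IsHermitian) :
    ∃ (b : a → ℝ) (u : a → a → ℂ), (∀ j, b j ∈ spectrum ℝ B) ∧
      ∀ f : ℝ → ℝ, cfc f B = ∑ j, f (b j) • pureState (u j) := by
  refine ⟨hB.eigenvalues, fun j i => (hB.eigenvectorUnitary : Matrix a a ℂ) i j,
    hB.eigenvalues_mem_spectrum_real, fun f => ?_⟩
  rw [hB.cfc_eq, IsHermitian.cfc, Unitary.conjStarAlgAut_apply]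
  ext i k
  rw [Matrix.mul_apply, Matrix.sum_apply]
  refine Finset.sum_congr rfl fun j _ => ?_
  simp [pureState, vecMulVec_apply, Matrix.mul_diagonal]
  ring

/-- `A* f(A A*) A = A* A f(A* A)`. -/
theorem conjTranspose_mul_cfc_mul (f : ℝ → ℝ) (A : Matrix a a ℂ) :
    Aᴴ * cfc f (A * Aᴴ) * A = cfc (fun x => x * f x) (Aᴴ * A) := by
  have h1 : IsSelfAdjoint (A * Aᴴ) := isHermitian_mul_conjTranspose_self A
  have h2 : IsSelfAdjoint (Aᴴ * A) := isHermitian_conjTranspose_mul_self A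
  let s : Finset ℝ := (A * Aᴴ).finite_real_spectrum.toFinset ∪
    (Aᴴ * A).finite_real_spectrum.toFinset
  -- Interpolating `f` on both spectra reduces the claim to `p(A A*) A = A p(A* A)` for polynomials
  -- `p`.
  let q : Polynomial ℝ := Lagrange.interpolate s id f
  have hq : ∀ x ∈ s, q.eval x = f x := fun x hx =>
    Lagrange.eval_interpolate_at_node (v := id) f (Set.injOn_id _) hx
  have e1 : cfc f (A * Aᴴ) = Polynomial.aeval (A * Aᴴ) q := by
    rw [← cfc_polynomial q (A * Aᴴ) h1]
    exact cfc_congr fun x hx => (hq x (by simp [s, hx])).symm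
  have e2 : cfc f (Aᴴ * A) = Polynomial.aeval (Aᴴ * A) q := by
    rw [← cfc_polynomial q (Aᴴ * A) h2]
    exact cfc_congr fun x hx => (hq x (by simp [s, hx])).symm
  have e3 : ∀ p : Polynomial ℝ,
      Polynomial.aeval (A * Aᴴ) p * A = A * Polynomial.aeval (Aᴴ * A) p := by
    intro p
    induction p using Polynomial.induction_on' with
    | add p q hp hq => simp only [map_add, add_mul, mul_add, hp, hq]
    | monomial n c =>
      simp only [Polynomial.aeval_monomial, mul_assoc]
      rw [← mul_assoc A, ← Algebra.commutes, mul_assoc]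
      congr 1
      induction n with
      | zero => simp
      | succ n ih => rw [pow_succ', pow_succ', mul_assoc, ih]; simp only [mul_assoc]
  have e4 : cfc (fun x => x * f x) (Aᴴ * A) = (Aᴴ * A) * cfc f (Aᴴ * A) := by
    rw [← cfc_mul_cfc, cfc_id' ℝ (Aᴴ * A)]
  rw [e4, e2, e1, mul_assoc, e3, mul_assoc]

/-! ### Pseudo-inverse square roots and the optimal splitting. -/

section SquareRoot

variable {X Y : Matrix a a ℂ}

/-- The square root of the pseudo-inverse. -/
noncomputable def sqrtPinv (Y : Matrix a a ℂ) : Matrix a a ℂ := cfc (fun t : ℝ => √(t⁻¹)) Y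

/-- The projection onto the support. -/
noncomputable def suppProj (Y : Matrix a a ℂ) : Matrix a a ℂ := cfc (fun t : ℝ => t * t⁻¹) Y

theorem PosSemidef.cfc_sqrt_mul_self (hY : Y.PosSemidef) :
    cfc Real.sqrt Y * cfc Real.sqrt Y = Y := by
  rw [cfc_mul_cfc]
  conv_rhs => rw [← cfc_id' ℝ Y hY.isHermitian]
  exact cfc_congr fun x hx => Real.mul_self_sqrt (hY.spectrum_nonneg hx)

theorem PosSemidef.sqrtPinv_mul_self (hY : Y.PosSemidef) :
    sqrtPinv Y * sqrtPinv Y = cfc (fun t : ℝ => t⁻¹) Y := by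
  rw [sqrtPinv, cfc_mul_cfc]
  exact cfc_congr fun x hx => Real.mul_self_sqrt (inv_nonneg.2 (hY.spectrum_nonneg hx))

theorem PosSemidef.cfc_sqrt_mul_sqrtPinv (hY : Y.PosSemidef) :
    cfc Real.sqrt Y * sqrtPinv Y = suppProj Y := by
  rw [sqrtPinv, cfc_mul_cfc]
  exact cfc_congr fun x hx => (Real.sqrt_mul (hY.spectrum_nonneg hx) _).symm.trans <| by
    by_cases h : x = 0 <;> simp [h]

theorem PosSemidef.sqrtPinv_mul_cfc_sqrt (hY : Y.PosSemidef) :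
    sqrtPinv Y * cfc Real.sqrt Y = suppProj Y := by
  rw [← hY.cfc_sqrt_mul_sqrtPinv]
  exact (cfc_commute_cfc _ _ Y).eq

theorem suppProj_mul_self : suppProj Y * suppProj Y = suppProj Y := by
  rw [suppProj, cfc_mul_cfc]
  exact cfc_congr fun x _ => by by_cases h : x = 0 <;> simp [h]

theorem isHermitian_suppProj : (suppProj Y).IsHermitian := isHermitian_cfc _ _

theorem PosSemidef.mul_suppProj (hY : Y.PosSemidef) : Y * suppProj Y = Y := by
  have hY' : IsSelfAdjoint Y := hY.isHermitian
  have h : cfc (fun x : ℝ => x) Y * suppProj Y = cfc (fun x : ℝ => x) Y := by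
    rw [suppProj, cfc_mul_cfc]
    exact cfc_congr fun x _ => by by_cases h : x = 0 <;> simp [h]
  rwa [cfc_id' ℝ Y] at h

/-- Since `Y P = Y` for the support projection `P` of `Y`, the columns of `1 - P` lie in `ker Y`,
hence in `ker X`. -/
theorem mul_suppProj_of_ker_le (hY : Y.PosSemidef)
    (h : LinearMap.ker Y.mulVecLin ≤ LinearMap.ker X.mulVecLin) : X * suppProj Y = X := by
  have h0 : X * (1 - suppProj Y) = 0 := by
    ext i j
    have h1 : Y *ᵥ ((1 - suppProj Y).col j) = 0 := by
      have : (Y * (1 - suppProj Y)).col j = 0 := by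
        rw [mul_sub, mul_one, hY.mul_suppProj, sub_self]; rfl
      exact this
    have h2 : X *ᵥ ((1 - suppProj Y).col j) = 0 :=
      LinearMap.mem_ker.1 (h (LinearMap.mem_ker.2 h1))
    exact congrFun h2 i
  rw [mul_sub, mul_one, sub_eq_zero] at h0
  exact h0.symm

theorem PosSemidef.cfc_sqrt_mul_suppProj (hX : X.PosSemidef) (h : X * suppProj Y = X) :
    cfc Real.sqrt X * suppProj Y = cfc Real.sqrt X := by
  have h0 : cfc Real.sqrt X * (1 - suppProj Y) = 0 := by
    rw [← conjTranspose_mul_self_eq_zero, conjTranspose_mul, (isHermitian_cfc _ X).eq, mul_assoc,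
      ← mul_assoc (cfc Real.sqrt X), hX.cfc_sqrt_mul_self, mul_sub, h, mul_one, sub_self, mul_zero]
  rw [mul_sub, mul_one, sub_eq_zero] at h0
  exact h0.symm

theorem suppProj_mul_of_mul_suppProj (hX : X.IsHermitian) (h : X * suppProj Y = X) :
    suppProj Y * X = X := by
  simpa [conjTranspose_mul, hX.eq, isHermitian_suppProj.eq] using congrArg conjTranspose h

theorem PosSemidef.suppProj_mul_cfc_sqrt (hY : Y.PosSemidef) :
    suppProj Y * cfc Real.sqrt Y = cfc Real.sqrt Y :=
  suppProj_mul_of_mul_suppProj (isHermitian_cfc _ _) (hY.cfc_sqrt_mul_suppProj hY.mul_suppProj)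

/-- The compression `Y^{-1/2} X Y^{-1/2}`. -/
noncomputable def relCompression (X Y : Matrix a a ℂ) : Matrix a a ℂ :=
  sqrtPinv Y * X * sqrtPinv Y

theorem PosSemidef.relCompression (hX : X.PosSemidef) (Y : Matrix a a ℂ) :
    (relCompression X Y).PosSemidef := by
  have := hX.mul_mul_conjTranspose_same (sqrtPinv Y)
  rwa [show (sqrtPinv Y)ᴴ = sqrtPinv Y from isHermitian_cfc _ Y] at this

/-- Put `A = X^{1/2} Y^{-1/2}`: the logarithm is taken at `A A*`, the compression is `A* A`, and the
support condition gives `A Y^{1/2} = X^{1/2}`. Moving `A` through the logarithm turns it into `x log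
x`. -/
theorem opRelEntropy_eq_of_ker_le (hX : X.PosSemidef) (hY : Y.PosSemidef)
    (h : LinearMap.ker Y.mulVecLin ≤ LinearMap.ker X.mulVecLin) :
    opRelEntropy X Y = cfc Real.sqrt Y *
      cfc (fun x => x * Real.log x) (X.relCompression Y) * cfc Real.sqrt Y := by
  have hXP := mul_suppProj_of_ker_le hY h
  set S := cfc Real.sqrt X with hS
  set T := sqrtPinv Y with hT
  have hSh : Sᴴ = S := isHermitian_cfc _ _
  have hTh : Tᴴ = T := isHermitian_cfc _ _
  have e1 : S * cfc (fun t : ℝ => t⁻¹) Y * S = (S * T) * (S * T)ᴴ := by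
    rw [conjTranspose_mul, hSh, hTh, ← hY.sqrtPinv_mul_self]; simp only [mul_assoc, hT]
  have e2 : X.relCompression Y = (S * T)ᴴ * (S * T) := by
    rw [conjTranspose_mul, hSh, hTh, relCompression, ← hX.cfc_sqrt_mul_self]
    simp only [mul_assoc, hT, hS]
  have e3 : S * T * cfc Real.sqrt Y = S := by
    rw [mul_assoc, hY.sqrtPinv_mul_cfc_sqrt, hS, hX.cfc_sqrt_mul_suppProj hXP]
  have e4 : cfc Real.sqrt Y * (S * T)ᴴ = S := by
    simpa [conjTranspose_mul, hSh, hTh, (isHermitian_cfc Real.sqrt Y).eq, mul_assoc] using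
      congrArg conjTranspose e3
  rw [opRelEntropy, e1, e2, ← conjTranspose_mul_cfc_mul, ← hS]
  nth_rewrite 1 [← e4]
  nth_rewrite 4 [← e3]
  simp only [mul_assoc]

/-- A common rank-one resolution of all the operators `Y^{1/2} f(Y^{-1/2} X Y^{-1/2}) Y^{1/2}`. -/
theorem PosSemidef.exists_sqrt_mul_cfc_mul_sqrt_eq_sum (hX : X.PosSemidef) (Y : Matrix a a ℂ) :
    ∃ (b : a → ℝ) (s : a → a → ℂ), (∀ j, 0 ≤ b j) ∧
      ∀ f : ℝ → ℝ, cfc Real.sqrt Y * cfc f (X.relCompression Y) * cfc Real.sqrt Y =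
        ∑ j, f (b j) • pureState (s j) := by
  obtain ⟨b, u, hb, hu⟩ := (hX.relCompression Y).isHermitian.exists_cfc_eq_sum
  refine ⟨b, fun j => cfc Real.sqrt Y *ᵥ u j,
    fun j => (hX.relCompression Y).spectrum_nonneg (hb j), fun f => ?_⟩
  rw [hu, Finset.mul_sum, Finset.sum_mul]
  refine Finset.sum_congr rfl fun j _ => ?_
  rw [← mul_pureState_mul _ (isHermitian_cfc _ _), mul_smul_comm, smul_mul_assoc]

theorem sqrt_mul_relCompression_mul_sqrt (hX : X.PosSemidef) (hY : Y.PosSemidef)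
    (h : LinearMap.ker Y.mulVecLin ≤ LinearMap.ker X.mulVecLin) :
    cfc Real.sqrt Y * X.relCompression Y * cfc Real.sqrt Y = X := by
  have hXP := mul_suppProj_of_ker_le hY h
  calc _ = (cfc Real.sqrt Y * sqrtPinv Y) * X * (sqrtPinv Y * cfc Real.sqrt Y) := by
        simp only [relCompression, mul_assoc]
    _ = X := by
        rw [hY.cfc_sqrt_mul_sqrtPinv, hY.sqrtPinv_mul_cfc_sqrt,
          suppProj_mul_of_mul_suppProj hX.isHermitian hXP, hXP]

/-- Simultaneous decomposition `Y = ∑ |s_j⟩⟨s_j|`, `X = ∑ b_j |s_j⟩⟨s_j|` that attains the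
operator relative entropy. -/
theorem exists_optimal_decomposition (hX : X.PosSemidef) (hY : Y.PosSemidef)
    (h : LinearMap.ker Y.mulVecLin ≤ LinearMap.ker X.mulVecLin) :
    ∃ (b : a → ℝ) (s : a → a → ℂ), (∀ j, 0 ≤ b j) ∧ Y = ∑ j, pureState (s j) ∧
      X = ∑ j, b j • pureState (s j) ∧
      (opRelEntropy X Y).trace.re = ∑ j, b j * Real.log (b j) * (pureState (s j)).trace.re := by
  obtain ⟨b, s, hb, hs⟩ := hX.exists_sqrt_mul_cfc_mul_sqrt_eq_sum Y
  have hB : IsSelfAdjoint (X.relCompression Y) := (hX.relCompression Y).isHermitian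
  -- One resolution serves every `f`: the choices `1`, `x` and `x log x` give `Y`, `X` and the
  -- entropy.
  refine ⟨b, s, hb, ?_, ?_, ?_⟩
  · have := hs fun _ => 1
    rw [cfc_const_one ℝ (X.relCompression Y), mul_one, hY.cfc_sqrt_mul_self] at this
    simpa using this
  · have := hs fun x => x
    rwa [cfc_id' ℝ (X.relCompression Y), sqrt_mul_relCompression_mul_sqrt hX hY h] at this
  · rw [opRelEntropy_eq_of_ker_le hX hY h, hs, trace_sum, Complex.re_sum]
    exact Finset.sum_congr rfl fun j _ => by rw [trace_smul, Complex.smul_re, smul_eq_mul]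

/-- For `R = Y^{1/2} (B + t)⁻¹ Y^{1/2}` with `B = Y^{-1/2} X Y^{-1/2}` there is `N` with
`Y N = R = N* (X + t Y) N`. -/
theorem exists_resolvent_factor (hX : X.PosSemidef) (hY : Y.PosSemidef)
    {t : ℝ} (ht : 0 < t) :
    ∃ N : Matrix a a ℂ,
      Y * N = cfc Real.sqrt Y * cfc (fun x => (x + t)⁻¹) (X.relCompression Y) * cfc Real.sqrt Y ∧
      Nᴴ * (X + t • Y) * N =
        cfc Real.sqrt Y * cfc (fun x => (x + t)⁻¹) (X.relCompression Y) * cfc Real.sqrt Y := by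
  set Q := cfc Real.sqrt Y with hQ
  set T := sqrtPinv Y with hT
  set P := suppProj Y with hP
  set B := X.relCompression Y with hB
  set G := cfc (fun x => (x + t)⁻¹) B with hG
  have hBpos : B.PosSemidef := hX.relCompression Y
  have hBsa : IsSelfAdjoint B := hBpos.isHermitian
  have hQh : Qᴴ = Q := isHermitian_cfc _ _
  have hTh : Tᴴ = T := isHermitian_cfc _ _
  have hGh : Gᴴ = G := isHermitian_cfc _ _
  have hQQ : Q * Q = Y := hY.cfc_sqrt_mul_self
  have hQT : Q * T = P := hY.cfc_sqrt_mul_sqrtPinv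
  have hTQ : T * Q = P := hY.sqrtPinv_mul_cfc_sqrt
  have hPQ : P * Q = Q := hY.suppProj_mul_cfc_sqrt
  have hQP : Q * P = Q := hY.cfc_sqrt_mul_suppProj hY.mul_suppProj
  have hTP : T * P = T := by
    rw [hT, hP, sqrtPinv, suppProj, cfc_mul_cfc]
    exact cfc_congr fun x _ => by by_cases h : x = 0 <;> simp [h]
  have hPT : P * T = T := suppProj_mul_of_mul_suppProj hTh hTP
  have hBt : B + t • 1 = cfc (fun x => x + t) B := by
    rw [cfc_add_const t (fun x => x) B, cfc_id' ℝ B, Algebra.algebraMap_eq_smul_one]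
  have hcong : ∀ x ∈ spectrum ℝ B, x + t ≠ 0 := fun x hx =>
    (add_pos_of_nonneg_of_pos (hBpos.spectrum_nonneg hx) ht).ne'
  have hG1 : G * (B + t • 1) = 1 := by
    rw [hBt, hG, cfc_mul_cfc, ← cfc_const_one ℝ B]
    exact cfc_congr fun x hx => inv_mul_cancel₀ (hcong x hx)
  have hG2 : (B + t • 1) * G = 1 := by
    rw [hBt, hG, cfc_mul_cfc, ← cfc_const_one ℝ B]
    exact cfc_congr fun x hx => mul_inv_cancel₀ (hcong x hx)
  have hPB : P * B = B := by rw [hB, relCompression, ← mul_assoc, ← mul_assoc, ← hT, hPT]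
  have hBP : B * P = B := by rw [hB, relCompression, mul_assoc, ← hT, hTP]
  have hcomm : P * (B + t • 1) = (B + t • 1) * P := by
    simp [mul_add, add_mul, hPB, hBP]
  have hPG : P * G = G * P := by
    calc P * G = G * (B + t • 1) * P * G := by rw [hG1, one_mul]
      _ = G * (P * (B + t • 1)) * G := by rw [hcomm]; simp only [mul_assoc]
      _ = G * P * ((B + t • 1) * G) := by simp only [mul_assoc]
      _ = G * P := by rw [hG2, mul_one]
  have hTYT : T * Y * T = P := by
    rw [← hQQ, ← mul_assoc, hTQ, mul_assoc, hQT, hP, suppProj_mul_self]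
  have hmid : T * (X + t • Y) * T = B + t • P := by
    rw [mul_add, add_mul, mul_smul_comm, smul_mul_assoc, hTYT]; rfl
  -- For invertible `Y` this is `(X + t Y)⁻¹ Y`.
  refine ⟨T * G * Q, ?_, ?_⟩
  · rw [← hQQ]
    calc Q * Q * (T * G * Q) = Q * (Q * T) * G * Q := by simp only [mul_assoc]
      _ = Q * G * Q := by rw [hQT, hQP]
  · calc (T * G * Q)ᴴ * (X + t • Y) * (T * G * Q)
        = Q * G * (T * (X + t • Y) * T) * G * Q := by
          simp only [conjTranspose_mul, hQh, hTh, hGh, mul_assoc]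
      _ = Q * G * ((B + t • 1) * P) * G * Q := by
          rw [hmid, add_mul, hBP, smul_mul_assoc, one_mul]
      _ = Q * (G * (B + t • 1)) * (P * G) * Q := by simp only [mul_assoc]
      _ = Q * G * (P * Q) := by rw [hG1, mul_one, hPG]; simp only [mul_assoc]
      _ = Q * G * Q := by rw [hPQ]

end SquareRoot

/-- Operator convexity of the resolvent, traced against `Y`. -/
theorem trace_resolvent_le {ι : Type*} [Fintype ι] {g : ι → ℝ} (hg : ∀ k, 0 ≤ g k)
    {M : ι → Matrix a a ℂ} (hM : ∀ k, (M k).PosSemidef) {t : ℝ} (ht : 0 < t) :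
    (cfc Real.sqrt (∑ k, M k) *
      cfc (fun x => (x + t)⁻¹) ((∑ k, g k • M k).relCompression (∑ k, M k)) *
      cfc Real.sqrt (∑ k, M k)).trace.re ≤ ∑ k, (g k + t)⁻¹ * (M k).trace.re := by
  have hY : (∑ k, M k).PosSemidef := posSemidef_sum _ fun k _ => hM k
  have hX : (∑ k, g k • M k).PosSemidef := posSemidef_sum _ fun k _ => (hM k).smul (hg k)
  obtain ⟨N, h1, h2⟩ := exists_resolvent_factor hX hY ht
  set R := cfc Real.sqrt (∑ k, M k) *
      cfc (fun x => (x + t)⁻¹) ((∑ k, g k • M k).relCompression (∑ k, M k)) *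
      cfc Real.sqrt (∑ k, M k)
  -- Expand `(1 - c N)* M_k (1 - c N) ≥ 0` with `c = g_k + t` and divide by `c`. After summing over
  -- `k`, the cross terms give `2 tr R` and the quadratic terms `tr R`.
  have key : ∀ k, 2 * (M k * N).trace.re ≤
      (g k + t)⁻¹ * (M k).trace.re + (g k + t) * (Nᴴ * M k * N).trace.re := by
    intro k
    have hc : 0 < g k + t := add_pos_of_nonneg_of_pos (hg k) ht
    set c := g k + t
    have h := ((hM k).conjTranspose_mul_mul_same (1 - c • N)).trace_re_nonneg
    have e : (1 - c • N)ᴴ * M k * (1 - c • N) =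
        M k - c • (Nᴴ * M k) - c • (M k * N) + c • c • (Nᴴ * M k * N) := by
      simp only [conjTranspose_sub, conjTranspose_one, conjTranspose_smul, star_trivial, sub_mul,
        mul_sub, one_mul, mul_one, smul_mul_assoc, mul_smul_comm, smul_sub]
      abel
    have e2 : (Nᴴ * M k).trace.re = (M k * N).trace.re := by
      rw [← (hM k).isHermitian.eq, ← conjTranspose_mul, trace_conjTranspose, (hM k).isHermitian.eq]
      simp
    rw [e] at h
    simp only [trace_add, trace_sub, trace_smul, Complex.add_re, Complex.sub_re, Complex.smul_re,
      smul_eq_mul, e2] at h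
    have h' := mul_nonneg (inv_nonneg.2 hc.le) h
    have : c⁻¹ * ((M k).trace.re - c * (M k * N).trace.re - c * (M k * N).trace.re +
        c * (c * (Nᴴ * M k * N).trace.re)) = c⁻¹ * (M k).trace.re - 2 * (M k * N).trace.re +
        c * (Nᴴ * M k * N).trace.re := by field_simp; ring
    linarith
  have s1 : ∑ k, (M k * N).trace.re = R.trace.re := by
    rw [← h1, Finset.sum_mul, trace_sum, Complex.re_sum]
  have s2 : ∑ k, (g k + t) * (Nᴴ * M k * N).trace.re = R.trace.re := by
    rw [← h2, Finset.smul_sum, ← Finset.sum_add_distrib, Finset.mul_sum, Finset.sum_mul, trace_sum,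
      Complex.re_sum]
    refine Finset.sum_congr rfl fun k _ => ?_
    rw [← add_smul, mul_smul_comm, smul_mul_assoc, trace_smul, Complex.smul_re, smul_eq_mul]
  have := Finset.sum_le_sum fun k (_ : k ∈ Finset.univ) => key k
  rw [Finset.sum_add_distrib, s2, ← Finset.mul_sum, s1] at this
  linarith

end Matrix

/-! ### From resolvents to `x log x`. -/

theorem Real.sum_mul_one_div_add {ι : Type*} [Fintype ι] {c : ι → ℝ} (w : ι → ℝ) {t : ℝ}
    (ht : 0 < t) (hc : ∀ i, 0 ≤ c i) :
    ∑ i, c i * w i * (1 / (t + c i)) = ∑ i, w i - t * ∑ i, (c i + t)⁻¹ * w i := by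
  rw [Finset.mul_sum, ← Finset.sum_sub_distrib]
  refine Finset.sum_congr rfl fun i _ => ?_
  have : t + c i ≠ 0 := by have := hc i; positivity
  rw [add_comm (c i) t]
  field_simp
  ring

open Filter Topology in
/-- A comparison of resolvent transforms of two finite measures on `[0, ∞)` with equal mass and
mean gives a comparison of their integrals of `x log x`. -/
theorem Real.sum_mul_log_le_of_sum_inv_add_le {ι κ : Type*} [Fintype ι] [Fintype κ]
    {b y : ι → ℝ} {g m : κ → ℝ} (hb : ∀ j, 0 ≤ b j) (hg : ∀ k, 0 ≤ g k)
    (h0 : ∑ j, y j = ∑ k, m k) (h1 : ∑ j, b j * y j = ∑ k, g k * m k)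
    (h : ∀ t, 0 < t → ∑ j, (b j + t)⁻¹ * y j ≤ ∑ k, (g k + t)⁻¹ * m k) :
    ∑ j, b j * Real.log (b j) * y j ≤ ∑ k, g k * Real.log (g k) * m k := by
  -- With equal masses, `φ'` is `t` times the resolvent gap, hence nonnegative. With equal means,
  -- `log t` can be subtracted for free, so `φ → 0` at infinity. Thus `φ ≤ 0`, and its limit at `0`
  -- is the desired difference.
  let φ : ℝ → ℝ := fun t =>
    ∑ j, b j * y j * Real.log (t + b j) - ∑ k, g k * m k * Real.log (t + g k)
  have hder : ∀ t, 0 < t → HasDerivAt φ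
      (∑ j, b j * y j * (1 / (t + b j)) - ∑ k, g k * m k * (1 / (t + g k))) t := by
    intro t ht
    refine HasDerivAt.sub (HasDerivAt.fun_sum fun j _ => HasDerivAt.const_mul _ ?_)
      (HasDerivAt.fun_sum fun k _ => HasDerivAt.const_mul _ ?_)
    · exact ((hasDerivAt_id t).add_const _).log (by have := hb j; positivity)
    · exact ((hasDerivAt_id t).add_const _).log (by have := hg k; positivity)
  have hmono : MonotoneOn φ (Set.Ioi 0) := by
    refine monotoneOn_of_deriv_nonneg (convex_Ioi 0)
      (fun t ht => (hder t ht).continuousAt.continuousWithinAt)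
      (fun t ht => (hder t (interior_subset ht)).differentiableAt.differentiableWithinAt)
      fun t ht => ?_
    have ht' : 0 < t := interior_subset ht
    rw [(hder t ht').deriv, sum_mul_one_div_add y ht' hb, sum_mul_one_div_add m ht' hg, h0]
    have := mul_le_mul_of_nonneg_left (h t ht') ht'.le
    linarith
  have hlim : Tendsto φ atTop (𝓝 0) := by
    have e : φ = fun t => ∑ j, b j * y j * (Real.log (t + b j) - Real.log t) -
        ∑ k, g k * m k * (Real.log (t + g k) - Real.log t) := by
      funext t
      simp only [φ, mul_sub, Finset.sum_sub_distrib, ← Finset.sum_mul, h1]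
      ring
    rw [e]
    have := (tendsto_finsetSum Finset.univ fun j _ =>
        (Real.tendsto_log_comp_add_sub_log (b j)).const_mul (b j * y j)).sub
      (tendsto_finsetSum Finset.univ fun k _ =>
        (Real.tendsto_log_comp_add_sub_log (g k)).const_mul (g k * m k))
    simpa using this
  have hneg : ∀ t, 0 < t → φ t ≤ 0 := fun t ht =>
    ge_of_tendsto hlim <| (eventually_ge_atTop t).mono fun s hs =>
      hmono ht (ht.trans_le hs) hs
  have hc : ∀ c w : ℝ, Tendsto (fun t => c * w * Real.log (t + c)) (𝓝[>] 0)
      (𝓝 (c * Real.log c * w)) := by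
    intro c w
    -- At `c = 0` the factor `c` cancels the divergence of the logarithm.
    rcases eq_or_ne c 0 with rfl | hc
    · simp
    · have : ContinuousAt (fun t : ℝ => c * w * Real.log (t + c)) 0 :=
        continuousAt_const.mul (ContinuousAt.log (by fun_prop) (by simpa using hc))
      have := this.tendsto.mono_left (nhdsWithin_le_nhds (s := Set.Ioi 0))
      simpa [mul_right_comm] using this
  have hlim0 : Tendsto φ (𝓝[>] 0)
      (𝓝 (∑ j, b j * Real.log (b j) * y j - ∑ k, g k * Real.log (g k) * m k)) :=
    (tendsto_finsetSum _ fun j _ => hc _ _).sub (tendsto_finsetSum _ fun k _ => hc _ _)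
  exact sub_nonpos.1 (le_of_tendsto hlim0 (eventually_mem_nhdsWithin.mono fun t ht => hneg t ht))

/-! ### Optimality among reverse tests. -/

namespace Matrix

variable {a : Type*} [Fintype a] [DecidableEq a]

/-- The Belavkin–Staszewski relative entropy is bounded by the classical relative entropy of every
simultaneous decomposition (reverse test). -/
theorem trace_opRelEntropy_sum_le {ι : Type*} [Fintype ι] {g : ι → ℝ} (hg : ∀ k, 0 ≤ g k)
    {M : ι → Matrix a a ℂ} (hM : ∀ k, (M k).PosSemidef) :
    (opRelEntropy (∑ k, g k • M k) (∑ k, M k)).trace.re ≤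
      ∑ k, g k * Real.log (g k) * (M k).trace.re := by
  have hY : (∑ k, M k).PosSemidef := posSemidef_sum _ fun k _ => hM k
  have hX : (∑ k, g k • M k).PosSemidef := posSemidef_sum _ fun k _ => (hM k).smul (hg k)
  have hker := ker_sum_le_ker_sum_smul g hM
  obtain ⟨b, s, hb, hs⟩ := hX.exists_sqrt_mul_cfc_mul_sqrt_eq_sum (∑ k, M k)
  have hB : IsSelfAdjoint ((∑ k, g k • M k).relCompression (∑ k, M k)) :=
    (hX.relCompression _).isHermitian
  have htr : ∀ f : ℝ → ℝ, (cfc Real.sqrt (∑ k, M k) *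
      cfc f ((∑ k, g k • M k).relCompression (∑ k, M k)) *
      cfc Real.sqrt (∑ k, M k)).trace.re = ∑ j, f (b j) * (pureState (s j)).trace.re := by
    intro f
    rw [hs, trace_sum, Complex.re_sum]
    exact Finset.sum_congr rfl fun j _ => by rw [trace_smul, Complex.smul_re, smul_eq_mul]
  rw [opRelEntropy_eq_of_ker_le hX hY hker, htr]
  refine Real.sum_mul_log_le_of_sum_inv_add_le hb hg ?_ ?_ fun t ht => ?_
  · have := htr fun _ => 1
    rw [cfc_const_one ℝ _ hB, mul_one, hY.cfc_sqrt_mul_self, trace_sum, Complex.re_sum] at this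
    simpa using this.symm
  · have := htr fun x => x
    rw [cfc_id' ℝ _ hB, sqrt_mul_relCompression_mul_sqrt hX hY hker, trace_sum,
      Complex.re_sum] at this
    rw [← this]
    exact Finset.sum_congr rfl fun j _ => by rw [trace_smul, Complex.smul_re, smul_eq_mul]
  · exact (htr fun x => (x + t)⁻¹).symm.trans_le (trace_resolvent_le hg hM ht)

end Matrix

open Matrix

/-! ### Channels and blocks of the reference system. -/

section Reference

variable {r r' a b ι : Type*}

theorem idTensorMap_sum_smul [Fintype ι] (𝒩 : Matrix a a ℂ →ₗ[ℂ] Matrix b b ℂ) (g : ι → ℝ)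
    (S : ι → Matrix (r × a) (r × a) ℂ) :
    idTensorMap r 𝒩 (∑ i, g i • S i) = ∑ i, g i • idTensorMap r 𝒩 (S i) := by
  ext p q
  have h : (Matrix.of fun i j => (∑ k, g k • S k) (p.1, i) (q.1, j)) =
      ∑ k, g k • (Matrix.of fun i j => S k (p.1, i) (q.1, j)) := by
    ext i j
    simp [Matrix.sum_apply]
  rw [idTensorMap, of_apply, h, map_sum]
  simp only [LinearMap.map_smul_of_tower, Matrix.sum_apply, Matrix.smul_apply, idTensorMap,
    of_apply]

theorem idTensorMap_sum [Fintype ι] (𝒩 : Matrix a a ℂ →ₗ[ℂ] Matrix b b ℂ)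
    (S : ι → Matrix (r × a) (r × a) ℂ) :
    idTensorMap r 𝒩 (∑ i, S i) = ∑ i, idTensorMap r 𝒩 (S i) := by
  simpa using idTensorMap_sum_smul 𝒩 (fun _ => 1) S

theorem idTensorMap_smul (𝒩 : Matrix a a ℂ →ₗ[ℂ] Matrix b b ℂ) (c : ℝ)
    (S : Matrix (r × a) (r × a) ℂ) :
    idTensorMap r 𝒩 (c • S) = c • idTensorMap r 𝒩 S := by
  simpa using idTensorMap_sum_smul 𝒩 (fun _ : Unit => c) fun _ => S

theorem idTensorMap_submatrix (𝒩 : Matrix a a ℂ →ₗ[ℂ] Matrix b b ℂ) (e : r → r')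
    (X : Matrix (r' × a) (r' × a) ℂ) :
    idTensorMap r 𝒩 (X.submatrix (Prod.map e id) (Prod.map e id)) =
      (idTensorMap r' 𝒩 X).submatrix (Prod.map e id) (Prod.map e id) :=
  rfl

variable [Fintype r] [Fintype r'] [Fintype ι]

/-- Only the diagonal blocks of a reference `ι × r` enter the trace over it. -/
theorem partialTraceLeft_eq_sum_submatrix (e : ι × r ≃ r') (X : Matrix (r' × a) (r' × a) ℂ) :
    partialTraceLeft X = ∑ i, partialTraceLeft (X.submatrix (Prod.map (fun k => e (i, k)) id)
      (Prod.map (fun k => e (i, k)) id)) := by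
  ext x y
  simp only [partialTraceLeft, Matrix.sum_apply, of_apply, submatrix_apply, Prod.map_apply,
    id_eq]
  rw [← e.sum_comp, Fintype.sum_prod_type]

theorem partialTraceLeft_sum (X : ι → Matrix (r × a) (r × a) ℂ) :
    partialTraceLeft (∑ i, X i) = ∑ i, partialTraceLeft (X i) := by
  ext x y
  simp only [partialTraceLeft, Matrix.sum_apply, of_apply]
  exact Finset.sum_comm

variable [Fintype a] [Fintype b]

theorem IsQuantumChannel.idTensorMap_posSemidef {𝒩 : Matrix a a ℂ →ₗ[ℂ] Matrix b b ℂ}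
    (h𝒩 : IsQuantumChannel 𝒩) {X : Matrix (r × a) (r × a) ℂ} (hX : X.PosSemidef) :
    (idTensorMap r 𝒩 X).PosSemidef := by
  let e := Fintype.equivFin r
  have h := (h𝒩.completelyPositive _ _
    (hX.submatrix (Prod.map e.symm id : Fin _ × a → r × a))).submatrix
      (Prod.map e id : r × b → Fin _ × b)
  rw [← idTensorMap_submatrix] at h
  convert h
  ext ⟨i, x⟩ ⟨j, y⟩
  simp

theorem IsQuantumChannel.trace_idTensorMap {𝒩 : Matrix a a ℂ →ₗ[ℂ] Matrix b b ℂ}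
    (h𝒩 : IsQuantumChannel 𝒩) (X : Matrix (r × a) (r × a) ℂ) :
    (idTensorMap r 𝒩 X).trace = X.trace := by
  simp only [Matrix.trace, Fintype.sum_prod_type]
  exact Finset.sum_congr rfl fun k _ =>
    h𝒩.tracePreserving (Matrix.of fun i j => X (k, i) (k, j))

theorem trace_eq_sum_trace_submatrix (e : ι × r ≃ r') (X : Matrix (r' × a) (r' × a) ℂ) :
    X.trace = ∑ i, (X.submatrix (Prod.map (fun k => e (i, k)) id)
      (Prod.map (fun k => e (i, k)) id)).trace := by
  simp only [Matrix.trace, Fintype.sum_prod_type, diag_apply, submatrix_apply, Prod.map_apply,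
    id_eq]
  rw [← e.sum_comp, Fintype.sum_prod_type]

theorem posSemidef_pureState (ψ : a → ℂ) : (pureState ψ).PosSemidef :=
  posSemidef_vecMulVec_self_star ψ

end Reference

/-! ### The purification built from a splitting. -/

section Purification

variable {r a ι : Type*} {n : ℕ}

/-- The purification `∑ i, √(g i) |i⟩ ⊗ |s i⟩` of `∑ i, g i |s i⟩⟨s i|`, with reference system
relabelled by `e`. -/
noncomputable def purification (e : ι × r ≃ Fin n) (g : ι → ℝ) (s : ι → r × a → ℂ) :
    Fin n × a → ℂ :=
  fun p => (√(g (e.symm p.1).1) : ℝ) * s (e.symm p.1).1 ((e.symm p.1).2, p.2)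

variable (e : ι × r ≃ Fin n) {g : ι → ℝ} (s : ι → r × a → ℂ)

/-- Diagonal blocks recover the weighted terms; this yields the marginal of the purification and
lets channel outputs be read block by block. -/
theorem pureState_purification_submatrix (hg : ∀ i, 0 ≤ g i) (i : ι) :
    (pureState (purification e g s)).submatrix (Prod.map (fun k => e (i, k)) id)
      (Prod.map (fun k => e (i, k)) id) = g i • pureState (s i) := by
  ext p q
  have h : ((√(g i) : ℝ) : ℂ) * (√(g i) : ℝ) = (g i : ℝ) := by
    rw [← Complex.ofReal_mul, Real.mul_self_sqrt (hg i)]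
  obtain ⟨k, x⟩ := p
  obtain ⟨l, y⟩ := q
  simp only [pureState, purification, submatrix_apply, vecMulVec_apply, Pi.star_apply, star_mul',
    Prod.map_apply, id_eq, Equiv.symm_apply_apply, Matrix.smul_apply, Complex.real_smul, ← h,
    Complex.star_def, Complex.conj_ofReal]
  ring

variable [Fintype r] [Fintype ι]

theorem isQuantumState_purification [Fintype a] (hg : ∀ i, 0 ≤ g i)
    (h : IsQuantumState (∑ i, g i • pureState (s i))) :
    IsQuantumState (pureState (purification e g s)) where
  posSemidef := posSemidef_pureState _
  trace_eq_one := by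
    simp only [trace_eq_sum_trace_submatrix e, pureState_purification_submatrix e s hg]
    rw [← trace_sum, h.trace_eq_one]

theorem partialTraceLeft_purification (hg : ∀ i, 0 ≤ g i) :
    partialTraceLeft (pureState (purification e g s)) =
      partialTraceLeft (∑ i, g i • pureState (s i)) := by
  simp only [partialTraceLeft_eq_sum_submatrix e, pureState_purification_submatrix e s hg,
    partialTraceLeft_sum]

end Purification

/-! ### Extended-real bounds and the chain rule. -/

section BSRelEntropy

variable {a b : Type*} [Fintype a] [Fintype b] [DecidableEq b]

theorem bsRelEntropy_ne_bot [DecidableEq a] (ρ σ : Matrix a a ℂ) : bsRelEntropy ρ σ ≠ ⊥ := by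
  unfold bsRelEntropy
  split_ifs
  exacts [EReal.coe_ne_bot _, top_ne_bot]

theorem bsRelEntropy_sum_le [DecidableEq a] {ι : Type*} [Fintype ι] {g : ι → ℝ} (hg : ∀ k, 0 ≤ g k)
    {M : ι → Matrix a a ℂ} (hM : ∀ k, (M k).PosSemidef) :
    bsRelEntropy (∑ k, g k • M k) (∑ k, M k) ≤
      ((∑ k, g k * Real.log (g k) * (M k).trace.re : ℝ) : EReal) := by
  rw [bsRelEntropy, if_pos (ker_sum_le_ker_sum_smul g hM), EReal.coe_le_coe_iff]
  exact trace_opRelEntropy_sum_le hg hM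

theorem exists_decomposition_of_bsRelEntropy_ne_top [DecidableEq a] {X Y : Matrix a a ℂ} (hX : X.PosSemidef)
    (hY : Y.PosSemidef) (h : bsRelEntropy X Y ≠ ⊤) :
    ∃ (b : a → ℝ) (s : a → a → ℂ), (∀ j, 0 ≤ b j) ∧ Y = ∑ j, pureState (s j) ∧
      X = ∑ j, b j • pureState (s j) ∧
      bsRelEntropy X Y =
        ((∑ j, b j * Real.log (b j) * (pureState (s j)).trace.re : ℝ) : EReal) := by
  unfold bsRelEntropy at h ⊢
  split_ifs at h ⊢ with hker
  · obtain ⟨b, s, hb, h1, h2, h3⟩ := exists_optimal_decomposition hX hY hker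
    exact ⟨b, s, hb, h1, h2, by rw [h3]⟩
  · exact absurd rfl h

theorem le_ecbsDivergence {H : Matrix a a ℂ} {E : ℝ}
    (𝒩 ℳ : Matrix a a ℂ →ₗ[ℂ] Matrix b b ℂ) {n : ℕ} {ψ : Fin n × a → ℂ}
    (hψ : IsQuantumState (pureState ψ))
    (hE : (H * partialTraceLeft (pureState ψ)).trace.re ≤ E) :
    bsRelEntropy (idTensorMap (Fin n) 𝒩 (pureState ψ)) (idTensorMap (Fin n) ℳ (pureState ψ)) ≤
      ecbsDivergence H E 𝒩 ℳ :=
  le_iSup₂_of_le n ψ <| le_iSup₂_of_le hψ hE le_rfl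

theorem ecbsDivergence_ne_bot [DecidableEq a] {r : Type*} [Fintype r] [DecidableEq r] {H : Matrix a a ℂ} {E : ℝ}
    (𝒩 ℳ : Matrix a a ℂ →ₗ[ℂ] Matrix b b ℂ) {ρ : Matrix (r × a) (r × a) ℂ}
    (hρ : IsQuantumState ρ) (hρE : (H * partialTraceLeft ρ).trace.re ≤ E) :
    ecbsDivergence H E 𝒩 ℳ ≠ ⊥ := by
  -- The pair `(ρ, ρ)` serves only to write `ρ` as a nonnegative combination of rank-one terms; its
  -- purification is then a feasible point.
  obtain ⟨g, s, hg, -, hs, -⟩ :=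
    exists_optimal_decomposition hρ.posSemidef hρ.posSemidef le_rfl
  subst hs
  have h := le_ecbsDivergence (H := H) (E := E) 𝒩 ℳ
    (isQuantumState_purification (Fintype.equivFin ((r × a) × r)) s hg hρ)
    (by rwa [partialTraceLeft_purification _ s hg])
  exact fun h0 => bsRelEntropy_ne_bot _ _ (le_bot_iff.1 (h0 ▸ h))

/-- The chain rule for a decomposed pair of input operators, in terms of a purification. -/
theorem bsRelEntropy_idTensorMap_sum_le {r ι : Type*} [Fintype r] [DecidableEq r] [Fintype ι]
    {n : ℕ} (e : ι × r ≃ Fin n) {𝒩 ℳ : Matrix a a ℂ →ₗ[ℂ] Matrix b b ℂ}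
    (h𝒩 : IsQuantumChannel 𝒩) (hℳ : IsQuantumChannel ℳ)
    {g : ι → ℝ} (hg : ∀ i, 0 ≤ g i) (s : ι → r × a → ℂ) :
    bsRelEntropy (idTensorMap r 𝒩 (∑ i, g i • pureState (s i)))
        (idTensorMap r ℳ (∑ i, pureState (s i))) ≤
      ((∑ i, g i * Real.log (g i) * (pureState (s i)).trace.re : ℝ) : EReal) +
      bsRelEntropy (idTensorMap (Fin n) 𝒩 (pureState (purification e g s)))
        (idTensorMap (Fin n) ℳ (pureState (purification e g s))) := by
  set ψ := purification e g s with hψ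
  by_cases htop : bsRelEntropy (idTensorMap (Fin n) 𝒩 (pureState ψ))
        (idTensorMap (Fin n) ℳ (pureState ψ)) = ⊤
  · rw [htop, EReal.coe_add_top]
    exact le_top
  have hψpos : (pureState ψ).PosSemidef := posSemidef_pureState ψ
  obtain ⟨h, w, hh, hY, hX, hval⟩ := exists_decomposition_of_bsRelEntropy_ne_top
    (h𝒩.idTensorMap_posSemidef hψpos) (hℳ.idTensorMap_posSemidef hψpos) htop
  rw [hval, ← EReal.coe_add]
  let T : ι → (Fin n × b) → Matrix (r × b) (r × b) ℂ := fun i k =>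
    (pureState (w k)).submatrix (Prod.map (fun k => e (i, k)) id)
      (Prod.map (fun k => e (i, k)) id)
  have hT : ∀ i k, (T i k).PosSemidef := fun i k => (posSemidef_pureState (w k)).submatrix _
  have hsub : ∀ (c : Fin n × b → ℝ) (i : ι),
      (∑ k, c k • pureState (w k)).submatrix (Prod.map (fun k => e (i, k)) id)
        (Prod.map (fun k => e (i, k)) id) = ∑ k, c k • T i k := by
    intro c i
    ext p q
    simp [T, Matrix.sum_apply]
  have hN : ∀ i, g i • idTensorMap r 𝒩 (pureState (s i)) = ∑ k, h k • T i k := by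
    intro i
    rw [← idTensorMap_smul, ← pureState_purification_submatrix e s hg, idTensorMap_submatrix,
      ← hψ, hX, hsub]
  have hM : ∀ i, g i • idTensorMap r ℳ (pureState (s i)) = ∑ k, T i k := by
    intro i
    rw [← idTensorMap_smul, ← pureState_purification_submatrix e s hg, idTensorMap_submatrix,
      ← hψ, hY]
    simpa using hsub (fun _ => 1) i
  have htrM : ∀ i, ∑ k, (T i k).trace.re = g i * (pureState (s i)).trace.re := by
    intro i
    rw [← Complex.re_sum, ← trace_sum, ← hM, trace_smul, hℳ.trace_idTensorMap,
      Complex.smul_re, smul_eq_mul]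
  have hT0 : ∀ i, g i = 0 → ∀ k, (T i k).trace.re = 0 := by
    intro i hi k
    have := htrM i
    rw [hi, zero_mul, Finset.sum_eq_zero_iff_of_nonneg fun k _ => (hT i k).trace_re_nonneg] at this
    exact this k (Finset.mem_univ k)
  -- Terms with `g_i = 0` are invisible in `ψ` but still contribute to `ℳ(σ)`. The right summand
  -- restores them with ratio `0`: since `0⁻¹ = 0`, the factor `1 - g_i⁻¹ g_i` is `1` exactly when
  -- `g_i = 0`, and `0` otherwise.
  let G : (ι × (Fin n × b)) ⊕ ι → ℝ := Sum.elim (fun p => g p.1 * h p.2) fun _ => 0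
  let M : (ι × (Fin n × b)) ⊕ ι → Matrix (r × b) (r × b) ℂ :=
    Sum.elim (fun p => (g p.1)⁻¹ • T p.1 p.2)
      fun i => (1 - (g i)⁻¹ * g i) • idTensorMap r ℳ (pureState (s i))
  have hG : ∀ x, 0 ≤ G x := by
    rintro (p | i)
    · exact mul_nonneg (hg _) (hh _)
    · exact le_rfl
  have hMpos : ∀ x, (M x).PosSemidef := by
    rintro (p | i)
    · exact (hT _ _).smul (inv_nonneg.2 (hg _))
    · refine (hℳ.idTensorMap_posSemidef (posSemidef_pureState _)).smul ?_
      by_cases hi : g i = 0 <;> simp [hi]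
  have e1 : idTensorMap r 𝒩 (∑ i, g i • pureState (s i)) = ∑ x, G x • M x := by
    rw [idTensorMap_sum_smul, Fintype.sum_sum_type, Fintype.sum_prod_type]
    simp only [G, M, Sum.elim_inl, Sum.elim_inr, zero_smul, Finset.sum_const_zero, add_zero]
    refine Finset.sum_congr rfl fun i _ => ?_
    by_cases hi : g i = 0
    · simp [hi]
    · rw [hN]
      refine Finset.sum_congr rfl fun k _ => ?_
      rw [smul_smul]
      congr 1
      field_simp
  have e2 : idTensorMap r ℳ (∑ i, pureState (s i)) = ∑ x, M x := by
    rw [idTensorMap_sum, Fintype.sum_sum_type, Fintype.sum_prod_type, ← Finset.sum_add_distrib]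
    simp only [M, Sum.elim_inl, Sum.elim_inr]
    refine Finset.sum_congr rfl fun i _ => ?_
    rw [← Finset.smul_sum, ← hM, smul_smul, ← add_smul]
    simp
  have e3 : ∑ x, G x * Real.log (G x) * (M x).trace.re =
      ∑ i, g i * Real.log (g i) * (pureState (s i)).trace.re +
        ∑ k, h k * Real.log (h k) * (pureState (w k)).trace.re := by
    have e4 : ∀ k, (pureState (w k)).trace.re = ∑ i, (T i k).trace.re := fun k => by
      rw [trace_eq_sum_trace_submatrix e, Complex.re_sum]
    simp only [e4, Finset.mul_sum]
    rw [Finset.sum_comm (s := (Finset.univ : Finset (Fin n × b))), ← Finset.sum_add_distrib,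
      Fintype.sum_sum_type, Fintype.sum_prod_type]
    simp only [G, M, Sum.elim_inl, Sum.elim_inr, zero_mul, Finset.sum_const_zero, add_zero]
    refine Finset.sum_congr rfl fun i _ => ?_
    by_cases hi : g i = 0
    · simp [hi, hT0 i hi]
    · have hlhs : g i * Real.log (g i) * (pureState (s i)).trace.re =
          ∑ k, Real.log (g i) * h k * (T i k).trace.re := by
        -- Trace preservation of `𝒩` collapses the `log g_i` part to the entropy of the input
        -- splitting.
        have hk : ∑ k, h k * (T i k).trace.re = g i * (pureState (s i)).trace.re := by
          have := congrArg (fun Z => Z.trace.re) (hN i)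
          simp only [trace_smul, h𝒩.trace_idTensorMap, trace_sum, Complex.re_sum,
            Complex.smul_re, smul_eq_mul] at this
          exact this.symm
        simp only [mul_assoc]
        rw [← Finset.mul_sum, hk]
        ring
      rw [hlhs, ← Finset.sum_add_distrib]
      refine Finset.sum_congr rfl fun k _ => ?_
      rw [trace_smul, Complex.smul_re, smul_eq_mul]
      by_cases hk : h k = 0
      · simp [hk]
      · rw [Real.log_mul hi hk]
        field_simp
  rw [e1, e2, ← e3]
  exact bsRelEntropy_sum_le hG hMpos

end BSRelEntropy

theorem mainTheorem1 {r a b : Type*} [Fintype r] [DecidableEq r] [Fintype a] [DecidableEq a]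
    [Fintype b] [DecidableEq b]
    (H : Matrix a a ℂ) (hH : IsGroundedHamiltonian H) (E : ℝ) (hE : 0 < E)
    (𝒩 ℳ : Matrix a a ℂ →ₗ[ℂ] Matrix b b ℂ)
    (h𝒩 : IsQuantumChannel 𝒩) (hℳ : IsQuantumChannel ℳ)
    (ρ σ : Matrix (r × a) (r × a) ℂ) (hρ : IsQuantumState ρ) (hσ : IsQuantumState σ)
    (hρE : (H * partialTraceLeft ρ).trace.re ≤ E) :
    bsRelEntropy (idTensorMap r 𝒩 ρ) (idTensorMap r ℳ σ) ≤
      bsRelEntropy ρ σ + ecbsDivergence H E 𝒩 ℳ := by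
  by_cases htop : bsRelEntropy ρ σ = ⊤
  · rw [htop, EReal.top_add_of_ne_bot (ecbsDivergence_ne_bot 𝒩 ℳ hρ hρE)]
    exact le_top
  obtain ⟨g, s, hg, h1, h2, h3⟩ :=
    exists_decomposition_of_bsRelEntropy_ne_top hρ.posSemidef hσ.posSemidef htop
  rw [h3]
  subst h1 h2
  let e := Fintype.equivFin ((r × a) × r)
  refine (bsRelEntropy_idTensorMap_sum_le e h𝒩 hℳ hg s).trans (add_le_add le_rfl ?_)
  exact le_ecbsDivergence 𝒩 ℳ (isQuantumState_purification e s hg hρ)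
    (by rwa [partialTraceLeft_purification _ s hg])
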